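/- For $d\ge 1$ and $g:\mathbb{R}^d\to\mathbb{R}$ let $$A(g):=\inf\{r>0:\ g(x)\ge 0\ \text{ whenever } |x|>r\}\in[0,\infty]\qquad(\inf\emptyset=\infty),$$ let $\widehat f(y)=\int_{\mathbb{R}^d} f(x)e^{-2\pi i x\cdot y}\,dx$ denote the Fourier transform (which is real-valued if $f$ is real-valued and radial), let $J_\nu$ denote the Bessel function of the first kind, $$J_\nu(u)=\Big(\frac u2\Big)^{\nu}\sum_{n=0}^\infty\frac{(-1)^n(u/2)^{2n}}{n!\,\Gamma(\nu+n+1)}\qquad(u>0),$$ and put $$\lambda_d:=-\inf_{u>0}\frac{\Gamma\big(\frac d2+1\big)J_{d/2}(u)}{(u/2)^{d/2}},$$ where the infimum is finite for every $d\ge2$. **Theorem.** Let $d\ge 2$. Let $f\in L^1(\mathbb{R}^d)$ be a nonzero, real-valued, continuous, radial function such that $\widehat f\in L^1(\mathbb{R}^d)$, $f(0)\le 0$ and $\widehat f(0)\le 0$. Then $$A(f)\,A(\widehat f)\ \ge\ \frac1\pi\left(\frac{1}{1+\lambda_d}\,\Gamma\Big(\frac d2+1\Big)\right)^{2/d},$$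 where the left-hand side may be $\infty$. Moreover, $\lambda_d<\frac12$ for every $d\ge2$, and $\lambda_d\to0$ exponentially fast as $d\to\infty$: there are constants $C$ and $q\in(0,1)$ such that $|\lambda_d|\le C q^{d}$ for all $d\ge2$. -/

import Mathlib

open MeasureTheory
open scoped FourierTransform ENNReal

/-- A function on `ℝ^d` is radial if its value at `x` depends only on `‖x‖`. -/
def IsRadial {d : ℕ} (f : EuclideanSpace ℝ (Fin d) → ℝ) : Prop :=
  ∀ x y, ‖x‖ = ‖y‖ → f x = f y

/-- `A(f) = inf {r > 0 : f(x) ≥ 0 if |x| > r}`, an element of `[0, ∞]`; it is `∞` if no such `r`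
exists. -/
noncomputable def signRadius {d : ℕ} (f : EuclideanSpace ℝ (Fin d) → ℝ) : ℝ≥0∞ :=
  sInf (ENNReal.ofReal '' {r : ℝ | 0 < r ∧ ∀ x, r < ‖x‖ → 0 ≤ f x})

/-- The Fourier transform `∫ f(x) e^{-2πi x·y} dx` of a real-valued function `f` on `ℝ^d`. -/
noncomputable def fourierC {d : ℕ} (f : EuclideanSpace ℝ (Fin d) → ℝ) :
    EuclideanSpace ℝ (Fin d) → ℂ :=
  𝓕 (fun x => (f x : ℂ))

/-- The Fourier transform as a real-valued function. For `f` even, in particular for `f` radial,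
`fourierC f` takes real values, so that no information is lost (see `fourierC_eq_ofReal`). -/
noncomputable def fourierR {d : ℕ} (f : EuclideanSpace ℝ (Fin d) → ℝ)
    (y : EuclideanSpace ℝ (Fin d)) : ℝ :=
  (fourierC f y).re

/-- The Fourier transform of a radial real-valued function is real-valued. -/
theorem fourierC_eq_ofReal {d : ℕ} {f : EuclideanSpace ℝ (Fin d) → ℝ} (hf : IsRadial f)
    (y : EuclideanSpace ℝ (Fin d)) : fourierC f y = (fourierR f y : ℂ) := by
  refine (Complex.conj_eq_iff_re.mp ?_).symm
  unfold fourierC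
  rw [Real.fourier_eq, ← integral_conj, ← integral_neg_eq_self]
  congr 1
  ext x
  have h : f (-x) = f x := hf _ _ (norm_neg x)
  simp [Circle.smul_def, h, ← Circle.coe_inv_eq_conj, ← AddChar.map_neg_eq_inv]

/-- The Bessel function of the first kind `J_ν(z)` for `ν > -1` and real `z > 0`. -/
noncomputable def besselJ (ν z : ℝ) : ℝ :=
  (z / 2) ^ ν *
    ∑' n : ℕ, (-1 : ℝ) ^ n * (z / 2) ^ (2 * n) / ((n.factorial : ℝ) * Real.Gamma (ν + n + 1))

/-- The function `u ↦ Γ(d/2 + 1) J_{d/2}(u) / (u/2)^{d/2}`, to be considered for `u > 0`. -/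
noncomputable def besselRatio (d : ℕ) (u : ℝ) : ℝ :=
  Real.Gamma ((d : ℝ) / 2 + 1) * besselJ ((d : ℝ) / 2) u / (u / 2) ^ ((d : ℝ) / 2)

/-- `λ_d = - inf_{u > 0} Γ(d/2 + 1) J_{d/2}(u) / (u/2)^{d/2}`. -/
noncomputable def besselLambda (d : ℕ) : ℝ :=
  -sInf (besselRatio d '' Set.Ioi 0)

/-! Write g for the Fourier transform of f, f⁻ and g⁻ for negative parts, and S = {f < 0}. If f ≥ 0
outside radius r, then S lies in the ball B of radius r, and ∫ f⁻ = -∫_S f = -∫ g·1̂_S. The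
transform of 1_S is at most |S|. Writing 1_S = 1_B - 1_{B∖S} shows that it is at least -λ_d|B| -
(|B| - |S|), because 1̂_B is |B| times the normalised Bessel function. Since ∫ g = f(0) ≤ 0, the
positive mass of g does not exceed its negative mass, so ∫ f⁻ ≤ (1 + λ_d)|B|·∫ g⁻
(`integral_negPart_le`). The same holds with f and g exchanged; multiplying the two inequalities and
cancelling the positive masses gives the bound on the product of the radii.

For λ_d, let F_ν be `normBessel ν`. It satisfies z F'' + (ν + 1) F' + F = 0 and F_ν' = -F_{ν+1}/(ν +
1). The energy F² + z F'² decreases, so if F is positive up to a, then -inf F is at most the square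
root of the energy at a (`besselLambda_le_of_energy_le`). An exponential upper bound on F
(`normBessel_le_exp`) makes that energy small. The choice a = (3/2)(ν + 1) gives λ_d < 1/2; a = (ν +
1)²/4 gives exponential decay. -/

/-! ### The normalised Bessel function: series, derivative, recurrence -/

/-- The `n`-th Taylor coefficient of `normBessel ν`. -/
noncomputable def normBesselCoeff (ν : ℝ) (n : ℕ) : ℝ :=
  (-1) ^ n * Real.Gamma (ν + 1) / (n.factorial * Real.Gamma (ν + n + 1))

/-- The entire function `z ↦ Γ(ν + 1) ∑ (-z)^n / (n! Γ(ν + n + 1))`, so that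
`Γ(ν + 1) J_ν(u) / (u / 2)^ν` is its value at `u² / 4`. -/
noncomputable def normBessel (ν z : ℝ) : ℝ := ∑' n : ℕ, normBesselCoeff ν n * z ^ n

theorem normBesselCoeff_zero {ν : ℝ} (hν : 0 ≤ ν) : normBesselCoeff ν 0 = 1 := by
  have : Real.Gamma (ν + 1) ≠ 0 := (Real.Gamma_pos_of_pos (by linarith)).ne'
  simp [normBesselCoeff, this]

theorem normBesselCoeff_succ {ν : ℝ} (hν : 0 ≤ ν) (n : ℕ) :
    normBesselCoeff ν (n + 1) = -normBesselCoeff ν n / ((n + 1) * (ν + n + 1)) := by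
  have h0 : (ν + n + 1 : ℝ) ≠ 0 := by positivity
  have h1 : Real.Gamma (ν + n + 1) ≠ 0 := (Real.Gamma_pos_of_pos (by positivity)).ne'
  have h2 : Real.Gamma (ν + ↑(n + 1) + 1) = (ν + n + 1) * Real.Gamma (ν + n + 1) := by
    rw [← Real.Gamma_add_one h0]; push_cast; ring_nf
  have h3 : (n.factorial : ℝ) ≠ 0 := by positivity
  rw [normBesselCoeff, normBesselCoeff, h2, Nat.factorial_succ]
  push_cast
  field_simp
  ring

theorem succ_mul_normBesselCoeff_succ {ν : ℝ} (hν : 0 ≤ ν) (n : ℕ) :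
    (n + 1) * normBesselCoeff ν (n + 1) = -normBesselCoeff (ν + 1) n / (ν + 1) := by
  have h0 : (ν + 1 : ℝ) ≠ 0 := by positivity
  have h1 : Real.Gamma (ν + 1 + n + 1) ≠ 0 := (Real.Gamma_pos_of_pos (by positivity)).ne'
  have h2 : Real.Gamma (ν + ↑(n + 1) + 1) = Real.Gamma (ν + 1 + n + 1) := by
    push_cast; ring_nf
  have h3 : (n.factorial : ℝ) ≠ 0 := by positivity
  rw [normBesselCoeff, normBesselCoeff, h2, Nat.factorial_succ, Real.Gamma_add_one h0]
  push_cast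
  field_simp
  ring

theorem abs_normBesselCoeff_le {ν : ℝ} (hν : 0 ≤ ν) (n : ℕ) :
    |normBesselCoeff ν n| ≤ 1 / n.factorial := by
  induction n with
  | zero => simp [normBesselCoeff_zero hν]
  | succ n ih =>
    rw [normBesselCoeff_succ hν, Nat.factorial_succ, abs_div, abs_neg,
      abs_of_pos (by positivity : (0 : ℝ) < (n + 1) * (ν + n + 1))]
    push_cast
    have h1 : (n + 1 : ℝ) ≤ (n + 1) * (ν + n + 1) := by
      have : (0 : ℝ) ≤ n := by positivity
      nlinarith
    calc |normBesselCoeff ν n| / ((n + 1) * (ν + n + 1))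
        ≤ (1 / n.factorial) / (n + 1) := by gcongr
      _ = 1 / ((n + 1) * n.factorial) := by field_simp

theorem summable_normBessel {ν : ℝ} (hν : 0 ≤ ν) (z : ℝ) :
    Summable fun n : ℕ => normBesselCoeff ν n * z ^ n := by
  refine Summable.of_norm_bounded (Real.summable_pow_div_factorial |z|) fun n => ?_
  rw [Real.norm_eq_abs, abs_mul, abs_pow]
  have := mul_le_mul_of_nonneg_right (abs_normBesselCoeff_le hν n) (pow_nonneg (abs_nonneg z) n)
  calc _ ≤ _ := this
    _ = _ := by ring

theorem normBessel_zero {ν : ℝ} (hν : 0 ≤ ν) : normBessel ν 0 = 1 := by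
  rw [normBessel, tsum_eq_single 0]
  · simp [normBesselCoeff_zero hν]
  · intro n hn; simp [hn]

theorem hasDerivAt_normBessel {ν : ℝ} (hν : 0 ≤ ν) (z : ℝ) :
    HasDerivAt (normBessel ν) (-normBessel (ν + 1) z / (ν + 1)) z := by
  set R : ℝ := |z| + 1
  have hR : 0 ≤ R := by positivity
  have hu : Summable fun n : ℕ => (n : ℝ) * R ^ (n - 1) / n.factorial := by
    rw [← summable_nat_add_iff 1]
    refine (Real.summable_pow_div_factorial R).congr fun n => ?_
    rw [Nat.factorial_succ]
    push_cast
    field_simp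
  have key := hasDerivAt_tsum_of_isPreconnected (𝕜 := ℝ) (F := ℝ)
    (g := fun (n : ℕ) (x : ℝ) => normBesselCoeff ν n * x ^ n)
    (g' := fun (n : ℕ) (x : ℝ) => normBesselCoeff ν n * (n * x ^ (n - 1)))
    (t := Set.Ioo (-R) R) (y₀ := 0) (y := z) hu isOpen_Ioo isPreconnected_Ioo
    (fun n y _ => (hasDerivAt_pow n y).const_mul _)
    (fun n y hy => by
      have hy' : |y| ≤ R := abs_le.2 ⟨hy.1.le, hy.2.le⟩
      rw [Real.norm_eq_abs, abs_mul, abs_mul, abs_pow, Nat.abs_cast]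
      calc _ ≤ 1 / n.factorial * (n * R ^ (n - 1)) := by
            gcongr
            exact abs_normBesselCoeff_le hν n
        _ = _ := by ring)
    (by constructor <;> simp only [R] <;> linarith [abs_nonneg z]) (summable_normBessel hν 0)
    (by constructor
        · have := neg_abs_le z; simp only [R]; linarith
        · have := le_abs_self z; simp only [R]; linarith)
  refine key.congr_deriv (Eq.symm ?_)
  have hs : Summable fun n : ℕ => normBesselCoeff ν n * (n * z ^ (n - 1)) := by
    rw [← summable_nat_add_iff 1]
    refine ((summable_normBessel (by positivity : (0 : ℝ) ≤ ν + 1) z).mul_left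
      (-1 / (ν + 1))).congr fun n => ?_
    have := succ_mul_normBesselCoeff_succ hν n
    rw [Nat.add_sub_cancel]
    push_cast
    linear_combination (-z ^ n) * this
  rw [hs.tsum_eq_zero_add]
  simp only [Nat.cast_zero, zero_mul, mul_zero, zero_add, Nat.add_sub_cancel]
  rw [normBessel, neg_div, ← neg_one_mul, ← tsum_div_const, ← tsum_mul_left]
  refine tsum_congr fun n => ?_
  have := succ_mul_normBesselCoeff_succ hν n
  push_cast
  linear_combination (-z ^ n) * this

theorem continuous_normBessel {ν : ℝ} (hν : 0 ≤ ν) : Continuous (normBessel ν) :=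
  continuous_iff_continuousAt.2 fun z => (hasDerivAt_normBessel hν z).continuousAt

/-- This is the differential equation z F'' + (ν + 1) F' + F = 0, with both derivatives expressed by
raising the index. -/
theorem normBessel_contiguous {ν : ℝ} (hν : 0 ≤ ν) (z : ℝ) :
    z * normBessel (ν + 2) z = (ν + 1) * (ν + 2) * (normBessel (ν + 1) z - normBessel ν z) := by
  have h1 : (0 : ℝ) ≤ ν + 1 := by positivity
  have h2 : (0 : ℝ) ≤ ν + 2 := by positivity
  have e : normBessel (ν + 1) z - normBessel ν z =
      ∑' n : ℕ, (normBesselCoeff (ν + 1) n * z ^ n - normBesselCoeff ν n * z ^ n) :=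
    ((summable_normBessel h1 z).tsum_sub (summable_normBessel hν z)).symm
  rw [e, ((summable_normBessel h1 z).sub (summable_normBessel hν z)).tsum_eq_zero_add]
  rw [normBesselCoeff_zero hν, normBesselCoeff_zero h1, sub_self, zero_add, normBessel,
    ← tsum_mul_left, ← tsum_mul_left]
  refine tsum_congr fun n => ?_
  have a1 := succ_mul_normBesselCoeff_succ hν n
  have a2 := succ_mul_normBesselCoeff_succ h1 n
  have a3 := normBesselCoeff_succ h1 n
  have a4 : normBesselCoeff ν (n + 1) = -normBesselCoeff (ν + 1) n / ((n + 1) * (ν + 1)) := by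
    have : (n + 1 : ℝ) ≠ 0 := by positivity
    rw [mul_comm, ← div_div, ← a1]; field_simp
  have a5 : normBesselCoeff (ν + 2) n = -((n + 1) * normBesselCoeff (ν + 1) (n + 1)) * (ν + 2) := by
    rw [a2, show ν + 1 + 1 = ν + 2 by ring]; field_simp
  have p1 : (n + 1 : ℝ) ≠ 0 := by positivity
  have p2 : (ν + 1 : ℝ) ≠ 0 := by positivity
  have p3 : (ν + 1 + n + 1 : ℝ) ≠ 0 := by positivity
  rw [a5, a4, a3]
  field_simp
  ring

/-! ### Bounds on the normalised Bessel function: energy, positivity, exponential decay -/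

/-- The energy `F² + z F'²` of a solution of `z F'' + (ν + 1) F' + F = 0` is nonincreasing. -/
theorem antitoneOn_energy {ν : ℝ} (hν : 0 ≤ ν) :
    AntitoneOn (fun z => normBessel ν z ^ 2 + z * (normBessel (ν + 1) z / (ν + 1)) ^ 2)
      (Set.Ici 0) := by
  have h1 : (0 : ℝ) ≤ ν + 1 := by positivity
  -- Eliminating z F'' by the differential equation leaves -(2ν + 1) F'².
  have hd : ∀ z, HasDerivAt
      (fun z => normBessel ν z ^ 2 + z * (normBessel (ν + 1) z / (ν + 1)) ^ 2)
      (-(2 * ν + 1) * (normBessel (ν + 1) z / (ν + 1)) ^ 2) z := by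
    intro z
    have d0 := hasDerivAt_normBessel hν z
    have d1 := hasDerivAt_normBessel h1 z
    refine ((d0.pow 2).add ((hasDerivAt_id' z).mul ((d1.div_const (ν + 1)).pow 2))).congr_deriv ?_
    have c := normBessel_contiguous hν z
    rw [show ν + 1 + 1 = ν + 2 by ring]
    have p1 : (ν + 1 : ℝ) ≠ 0 := by positivity
    have p2 : (ν + 2 : ℝ) ≠ 0 := by positivity
    simp only [Pi.pow_apply]
    push_cast
    field_simp
    linear_combination (-2 * normBessel (ν + 1) z) * c
  refine antitoneOn_of_deriv_nonpos (convex_Ici 0)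
    (fun z _ => (hd z).continuousAt.continuousWithinAt)
    (fun z _ => (hd z).differentiableAt.differentiableWithinAt) fun z _ => ?_
  rw [(hd z).deriv]
  have : 0 ≤ (normBessel (ν + 1) z / (ν + 1)) ^ 2 := sq_nonneg _
  nlinarith

theorem normBessel_sq_le {ν a z : ℝ} (hν : 0 ≤ ν) (ha : 0 ≤ a) (haz : a ≤ z) :
    normBessel ν z ^ 2 ≤ normBessel ν a ^ 2 + a * (normBessel (ν + 1) a / (ν + 1)) ^ 2 := by
  have := antitoneOn_energy hν (Set.mem_Ici.2 ha) (Set.mem_Ici.2 (ha.trans haz)) haz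
  have h2 : 0 ≤ z * (normBessel (ν + 1) z / (ν + 1)) ^ 2 :=
    mul_nonneg (ha.trans haz) (sq_nonneg _)
  simp only at this
  linarith

theorem abs_normBessel_le_one {ν z : ℝ} (hν : 0 ≤ ν) (hz : 0 ≤ z) : |normBessel ν z| ≤ 1 := by
  have := normBessel_sq_le hν le_rfl hz
  rw [normBessel_zero hν] at this
  exact abs_le_one_iff_mul_self_le_one.2 (by nlinarith)

theorem le_of_hasDerivAt_le_of_nonneg {f g f' g' : ℝ → ℝ} {b : ℝ} (hb : 0 ≤ b)
    (hf : ∀ x, HasDerivAt f (f' x) x) (hg : ∀ x, HasDerivAt g (g' x) x) (h0 : f 0 ≤ g 0)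
    (h : ∀ x, 0 ≤ x → x ≤ b → f' x ≤ g' x) : f b ≤ g b := by
  have hd : ∀ x, HasDerivAt (fun x => g x - f x) (g' x - f' x) x := fun x => (hg x).sub (hf x)
  have : MonotoneOn (fun x => g x - f x) (Set.Icc 0 b) := by
    refine monotoneOn_of_deriv_nonneg (convex_Icc 0 b)
      (fun z _ => (hd z).continuousAt.continuousWithinAt)
      (fun z _ => (hd z).differentiableAt.differentiableWithinAt) fun z hz => ?_
    rw [interior_Icc] at hz
    rw [(hd z).deriv]
    linarith [h z hz.1.le hz.2.le]
  have := this (Set.left_mem_Icc.2 hb) (Set.right_mem_Icc.2 hb) hb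
  simp only at this
  linarith

/-- A Riccati-type argument: up to the first zero m, the function G = F' + bF is nonnegative, so
exp(bx) F is nondecreasing from the value 1 and cannot vanish at m. -/
theorem normBessel_pos {ν z : ℝ} (hν : 0 ≤ ν) (hz : 0 ≤ z) (hz' : z ≤ (ν + 1) ^ 2 / 4) :
    0 < normBessel ν z := by
  by_contra! hneg
  have hν1 : 0 < ν + 1 := by positivity
  have hc := continuous_normBessel hν
  obtain ⟨m, ⟨⟨hm0, hmz⟩, hm⟩, hmin⟩ :=
    (isCompact_Icc.inter_right (isClosed_Iic.preimage hc) :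
      IsCompact (Set.Icc 0 z ∩ normBessel ν ⁻¹' Set.Iic 0)).exists_isLeast
      ⟨z, ⟨hz, le_rfl⟩, hneg⟩
  have hpos : ∀ x, 0 ≤ x → x < m → 0 < normBessel ν x := by
    intro x hx hxm
    by_contra! h
    exact absurd (hmin ⟨⟨hx, hxm.le.trans hmz⟩, h⟩) (not_le.2 hxm)
  -- The argument needs b²x - (ν + 1)b + 1 ≤ 0; this b allows the largest range of x, namely x ≤ (ν
  -- + 1)²/4.
  set b : ℝ := 2 / (ν + 1) with hb
  set G : ℝ → ℝ := fun x => -normBessel (ν + 1) x / (ν + 1) + b * normBessel ν x with hG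
  have hGd : ∀ x, HasDerivAt G (-(-normBessel (ν + 2) x / (ν + 2)) / (ν + 1) +
      b * (-normBessel (ν + 1) x / (ν + 1))) x := by
    intro x
    have d1 := hasDerivAt_normBessel hν1.le x
    rw [show ν + 1 + 1 = ν + 2 by ring] at d1
    exact (d1.neg.div_const _).add ((hasDerivAt_normBessel hν x).const_mul b)
  have hGc : Continuous G := continuous_iff_continuousAt.2 fun x => (hGd x).continuousAt
  -- The integrating factor x^(ν+1) exp(-bx) removes F' and F'' from the derivative, leaving a
  -- multiple of F. It also vanishes at 0, which gives G ≥ 0.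
  have hmono : MonotoneOn (fun x => x ^ (ν + 1) * (Real.exp (-b * x) * G x)) (Set.Icc 0 m) := by
    refine monotoneOn_of_deriv_nonneg (convex_Icc 0 m) ?_ ?_ ?_
    · refine ContinuousOn.mul ?_ (by fun_prop)
      exact (Real.continuous_rpow_const hν1.le).continuousOn
    · intro x hx
      rw [interior_Icc] at hx
      have := (Real.hasDerivAt_rpow_const (x := x) (p := ν + 1) (Or.inl hx.1.ne')).mul
        ((((hasDerivAt_id' x).const_mul (-b)).exp).mul (hGd x))
      exact this.differentiableAt.differentiableWithinAt
    · intro x hx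
      rw [interior_Icc] at hx
      have := (Real.hasDerivAt_rpow_const (x := x) (p := ν + 1) (Or.inl hx.1.ne')).mul
        ((((hasDerivAt_id' x).const_mul (-b)).exp).mul (hGd x))
      have h2 := this.deriv
      have hxp : x ^ (ν + 1) = x ^ ν * x := Real.rpow_add_one hx.1.ne' ν
      have hfin : deriv (fun x => x ^ (ν + 1) * (Real.exp (-b * x) * G x)) x =
          x ^ ν * Real.exp (-b * x) * (normBessel ν x * (1 - 4 * x / (ν + 1) ^ 2)) := by
        refine h2.trans ?_
        rw [hxp, add_sub_cancel_right, Pi.mul_apply]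
        simp only [hG, hb]
        have c := normBessel_contiguous hν x
        have p1 : (ν + 1 : ℝ) ≠ 0 := by positivity
        have p2 : (ν + 2 : ℝ) ≠ 0 := by positivity
        field_simp
        linear_combination x ^ ν * (ν + 1) * c
      rw [hfin]
      have : 4 * x / (ν + 1) ^ 2 ≤ 1 := by
        rw [div_le_one (by positivity)]
        linarith [hx.2, hmz]
      exact mul_nonneg (mul_nonneg (Real.rpow_nonneg hx.1.le _) (Real.exp_pos _).le)
        (mul_nonneg (hpos x hx.1.le hx.2).le (by linarith))
  have hGnn : ∀ x, 0 < x → x < m → 0 ≤ G x := by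
    intro x hx hxm
    have h := hmono (Set.left_mem_Icc.2 hm0) ⟨hx.le, hxm.le⟩ hx.le
    simp only [Real.zero_rpow hν1.ne', zero_mul] at h
    rw [← mul_assoc] at h
    exact nonneg_of_mul_nonneg_right h
      (mul_pos (Real.rpow_pos_of_pos hx _) (Real.exp_pos _))
  have hQd : ∀ x, HasDerivAt (fun x => Real.exp (b * x) * normBessel ν x)
      (Real.exp (b * x) * G x) x := by
    intro x
    refine ((((hasDerivAt_id' x).const_mul b).exp).mul (hasDerivAt_normBessel hν x)).congr_deriv ?_
    simp only [hG]
    ring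
  have hQ : MonotoneOn (fun x => Real.exp (b * x) * normBessel ν x) (Set.Icc 0 m) := by
    refine monotoneOn_of_deriv_nonneg (convex_Icc 0 m)
      (fun z _ => (hQd z).continuousAt.continuousWithinAt)
      (fun z _ => (hQd z).differentiableAt.differentiableWithinAt) fun x hx => ?_
    rw [interior_Icc] at hx
    rw [(hQd x).deriv]
    exact mul_nonneg (Real.exp_pos _).le (hGnn x hx.1 hx.2)
  have h := hQ (Set.left_mem_Icc.2 hm0) (Set.right_mem_Icc.2 hm0) hm0
  simp only [mul_zero, Real.exp_zero, normBessel_zero hν, mul_one] at h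
  have hm' : normBessel ν m ≤ 0 := hm
  nlinarith [Real.exp_pos (b * m)]

/-- By `normBessel_contiguous`, F_{ν+2} ≥ 0 forces F_{ν+1} ≥ F_ν, that is F_ν' ≤ -F_ν/(ν + 1). -/
theorem normBessel_le_exp {ν z : ℝ} (hν : 0 ≤ ν) (hz : 0 ≤ z)
    (h : ∀ x, 0 ≤ x → x ≤ z → 0 ≤ normBessel (ν + 2) x) :
    normBessel ν z ≤ Real.exp (-z / (ν + 1)) := by
  have hν1 : 0 < ν + 1 := by positivity
  have hd : ∀ x, HasDerivAt (fun x => Real.exp (1 / (ν + 1) * x) * normBessel ν x)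
      (Real.exp (1 / (ν + 1) * x) * ((normBessel ν x - normBessel (ν + 1) x) / (ν + 1))) x := by
    intro x
    refine ((((hasDerivAt_id' x).const_mul (1 / (ν + 1))).exp).mul
      (hasDerivAt_normBessel hν x)).congr_deriv ?_
    ring
  have := le_of_hasDerivAt_le_of_nonneg hz hd (fun x => hasDerivAt_const x (1 : ℝ))
    (by simp [normBessel_zero hν]) fun x hx hxz => by
      have c := normBessel_contiguous hν x
      have h1 : 0 ≤ normBessel (ν + 1) x - normBessel ν x := by
        have : 0 ≤ (ν + 1) * (ν + 2) * (normBessel (ν + 1) x - normBessel ν x) :=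
          c ▸ mul_nonneg hx (h x hx hxz)
        exact nonneg_of_mul_nonneg_right this (by positivity)
      refine mul_nonpos_of_nonneg_of_nonpos (Real.exp_pos _).le ?_
      exact div_nonpos_of_nonpos_of_nonneg (by linarith) hν1.le
  rw [neg_div, Real.exp_neg, ← one_div, le_div_iff₀ (Real.exp_pos _), mul_comm]
  rwa [one_div_mul_eq_div] at this

/-- Integrating the bound F ≤ 1 three times: each integration lowers the index by one and reverses
the inequality. -/
theorem cubic_le_normBessel {ν z : ℝ} (hν : 0 ≤ ν) (hz : 0 ≤ z) :
    1 - z / (ν + 1) + z ^ 2 / (2 * (ν + 1) * (ν + 2)) -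
      z ^ 3 / (6 * (ν + 1) * (ν + 2) * (ν + 3)) ≤ normBessel ν z := by
  have lin : ∀ {μ x : ℝ}, 0 ≤ μ → 0 ≤ x → 1 - x / (μ + 1) ≤ normBessel μ x := by
    intro μ x hμ hx
    refine le_of_hasDerivAt_le_of_nonneg (f' := fun _ => -(1 / (μ + 1))) hx
      (fun y => ((hasDerivAt_id' y).div_const _).const_sub 1)
      (hasDerivAt_normBessel hμ) (by simp [normBessel_zero hμ]) fun y hy _ => ?_
    rw [neg_div, neg_le_neg_iff]
    gcongr
    exact (abs_le.1 (abs_normBessel_le_one (by positivity) hy)).2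
  have quad : ∀ {μ x : ℝ}, 0 ≤ μ → 0 ≤ x →
      normBessel μ x ≤ 1 - x / (μ + 1) + x ^ 2 / (2 * (μ + 1) * (μ + 2)) := by
    intro μ x hμ hx
    refine le_of_hasDerivAt_le_of_nonneg (f := normBessel μ)
      (g := fun x => 1 - x / (μ + 1) + x ^ 2 / (2 * (μ + 1) * (μ + 2)))
      (g' := fun y => -(1 / (μ + 1)) + (2 : ℕ) * y ^ (2 - 1) / (2 * (μ + 1) * (μ + 2))) hx
      (hasDerivAt_normBessel hμ)
      (fun y => (((hasDerivAt_id' y).div_const _).const_sub 1).add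
        ((hasDerivAt_pow 2 y).div_const _)) (by simp [normBessel_zero hμ]) fun y hy _ => ?_
    have := lin (μ := μ + 1) (by positivity) hy
    have e : -(1 / (μ + 1)) + (2 : ℕ) * y ^ (2 - 1) / (2 * (μ + 1) * (μ + 2)) =
        -(1 - y / (μ + 1 + 1)) / (μ + 1) := by
      rw [show μ + 1 + 1 = μ + 2 by ring]
      push_cast
      field_simp
      ring
    rw [e]
    gcongr
  refine le_of_hasDerivAt_le_of_nonneg (g := normBessel ν)
    (f := fun z => 1 - z / (ν + 1) + z ^ 2 / (2 * (ν + 1) * (ν + 2)) -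
      z ^ 3 / (6 * (ν + 1) * (ν + 2) * (ν + 3)))
    (f' := fun y => -(1 / (ν + 1)) + (2 : ℕ) * y ^ (2 - 1) / (2 * (ν + 1) * (ν + 2)) -
      (3 : ℕ) * y ^ (3 - 1) / (6 * (ν + 1) * (ν + 2) * (ν + 3))) hz
    (fun y => ((((hasDerivAt_id' y).div_const _).const_sub 1).add
        ((hasDerivAt_pow 2 y).div_const _)).sub ((hasDerivAt_pow 3 y).div_const _))
    (hasDerivAt_normBessel hν) (by simp [normBessel_zero hν]) fun y hy _ => ?_
  have := quad (μ := ν + 1) (by positivity) hy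
  have e : -(1 / (ν + 1)) + (2 : ℕ) * y ^ (2 - 1) / (2 * (ν + 1) * (ν + 2)) -
      (3 : ℕ) * y ^ (3 - 1) / (6 * (ν + 1) * (ν + 2) * (ν + 3)) =
      -(1 - y / (ν + 1 + 1) + y ^ 2 / (2 * (ν + 1 + 1) * (ν + 1 + 2))) / (ν + 1) := by
    rw [show ν + 1 + 1 = ν + 2 by ring, show ν + 1 + 2 = ν + 3 by ring]
    push_cast
    field_simp
    ring
  rw [e]
  gcongr

theorem normBessel_pos_of_le_mul {ν z : ℝ} (hν : 1 ≤ ν) (hz : 0 ≤ z)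
    (hz' : z ≤ 3 / 2 * (ν + 1)) : 0 < normBessel ν z := by
  refine lt_of_lt_of_le ?_ (cubic_le_normBessel (by linarith) hz)
  have hν1 : 0 < ν + 1 := by linarith
  obtain ⟨s, rfl⟩ : ∃ s, z = s * (ν + 1) := ⟨z / (ν + 1), by field_simp⟩
  have hs : 0 ≤ s := nonneg_of_mul_nonneg_left hz hν1
  have hs' : s ≤ 3 / 2 := le_of_mul_le_mul_right hz' hν1
  -- Each summand has a sign: the second because ν ≥ 1, the third because s ≤ 3/2; the square is
  -- strictly positive since s < 2.
  have e : 1 - s * (ν + 1) / (ν + 1) + (s * (ν + 1)) ^ 2 / (2 * (ν + 1) * (ν + 2)) -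
      (s * (ν + 1)) ^ 3 / (6 * (ν + 1) * (ν + 2) * (ν + 3)) = (1 - s / 2) ^ 2 +
      s ^ 2 * ((ν - 1) / (4 * (ν + 2) * (ν + 3))) +
      s ^ 2 * (3 / 2 - s) * ((ν + 1) ^ 2 / (6 * (ν + 2) * (ν + 3))) := by
    field_simp
    ring
  rw [e]
  have a1 : 0 < (1 - s / 2) ^ 2 := by
    have : 0 < 1 - s / 2 := by linarith
    positivity
  have a2 : 0 ≤ s ^ 2 * ((ν - 1) / (4 * (ν + 2) * (ν + 3))) :=
    mul_nonneg (sq_nonneg _) (div_nonneg (by linarith) (by positivity))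
  have a3 : 0 ≤ s ^ 2 * (3 / 2 - s) * ((ν + 1) ^ 2 / (6 * (ν + 2) * (ν + 3))) :=
    mul_nonneg (mul_nonneg (sq_nonneg _) (by linarith)) (by positivity)
  linarith

/-! ### The Fourier transform of a ball, from Gaussian moments -/

theorem setIntegral_ball_of_homogeneous {d k : ℕ} {φ : EuclideanSpace ℝ (Fin d) → ℝ}
    (hk : ∀ (s : ℝ) x, φ (s • x) = s ^ k * φ x) {s : ℝ} (hs : 0 < s) :
    ∫ x in Metric.ball 0 s, φ x = s ^ (k + d) * ∫ x in Metric.ball 0 1, φ x := by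
  have h := Measure.setIntegral_comp_smul_of_pos volume φ (Metric.ball 0 1) hs
  simp only [hk] at h
  rw [integral_const_mul, smul_unitBall_of_pos hs, finrank_euclideanSpace_fin, smul_eq_mul] at h
  have : s ^ d ≠ 0 := by positivity
  rw [pow_add, mul_right_comm, h]
  field_simp

theorem integral_Ioi_mul_exp_neg_sq {a : ℝ} (ha : 0 ≤ a) :
    ∫ s in Set.Ioi a, 2 * s * Real.exp (-s ^ 2) = Real.exp (-a ^ 2) := by
  have hd : ∀ x : ℝ, HasDerivAt (fun s : ℝ => -Real.exp (-s ^ 2))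
      (2 * x * Real.exp (-x ^ 2)) x := by
    intro x
    refine (((hasDerivAt_pow 2 x).neg).exp.neg).congr_deriv ?_
    rw [Pi.neg_apply]
    push_cast
    ring
  have hlim : Filter.Tendsto (fun s : ℝ => -Real.exp (-s ^ 2)) Filter.atTop (nhds (-0)) := by
    refine (Real.tendsto_exp_atBot.comp ?_).neg
    exact Filter.tendsto_neg_atTop_atBot.comp (Filter.tendsto_pow_atTop two_ne_zero)
  have := integral_Ioi_of_hasDerivAt_of_nonneg (a := a)
    (hd a).continuousAt.continuousWithinAt (fun x _ => hd x)
    (fun x hx => by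
      have : 0 < x := lt_of_le_of_lt ha hx
      positivity) hlim
  rw [this]
  ring

theorem integrableOn_Ioi_pow_mul_exp_neg_sq (m : ℕ) :
    IntegrableOn (fun s : ℝ => s ^ m * Real.exp (-s ^ 2)) (Set.Ioi 0) := by
  have := integrableOn_rpow_mul_exp_neg_mul_sq (b := 1) one_pos (s := m)
    (by linarith [(Nat.cast_nonneg m : (0 : ℝ) ≤ m)])
  simpa using this

theorem integral_Ioi_pow_mul_exp_neg_sq (m : ℕ) :
    ∫ s in Set.Ioi (0 : ℝ), s ^ m * Real.exp (-s ^ 2) = Real.Gamma ((m + 1) / 2) / 2 := by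
  have := integral_rpow_mul_exp_neg_rpow (p := 2) (q := m) two_pos
    (by linarith [(Nat.cast_nonneg m : (0 : ℝ) ≤ m)])
  rw [one_div_mul_eq_div] at this
  rw [← this]
  simp

/-- The Gaussian integral of a homogeneous function in terms of its integral over the ball. -/
theorem integral_mul_exp_neg_norm_sq_of_homogeneous {d k : ℕ} {φ : EuclideanSpace ℝ (Fin d) → ℝ}
    (hφ : Continuous φ) (hk : ∀ (s : ℝ) x, φ (s • x) = s ^ k * φ x) :
    ∫ x, φ x * Real.exp (-‖x‖ ^ 2) =
      Real.Gamma (((k + d : ℕ) : ℝ) / 2 + 1) * ∫ x in Metric.ball 0 1, φ x := by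
  -- Since exp(-‖x‖²) = ∫_{s > ‖x‖} 2s exp(-s²) ds, integrating `h` in s first gives the Gaussian
  -- integral, and in x first gives integrals over balls, which scale by homogeneity.
  set h : EuclideanSpace ℝ (Fin d) → ℝ → ℝ := fun x s =>
    Set.indicator {p : EuclideanSpace ℝ (Fin d) × ℝ | ‖p.1‖ < p.2}
      (fun p => φ p.1 * (2 * p.2 * Real.exp (-p.2 ^ 2))) (x, s) with hh
  have hS : MeasurableSet {p : EuclideanSpace ℝ (Fin d) × ℝ | ‖p.1‖ < p.2} :=
    (isOpen_lt (by fun_prop) (by fun_prop)).measurableSet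
  have hx : ∀ s x, h x s = Set.indicator (Metric.ball 0 s) φ x *
      (2 * s * Real.exp (-s ^ 2)) := by
    intro s x
    by_cases hxs : ‖x‖ < s
    · rw [Set.indicator_of_mem (by simpa using hxs)]
      simp only [hh]
      rw [Set.indicator_of_mem (by exact hxs)]
    · rw [Set.indicator_of_notMem (by simpa using hxs)]
      simp only [hh]
      rw [Set.indicator_of_notMem (by exact hxs), zero_mul]
  have hs : ∀ s x, h x s = φ x * Set.indicator (Set.Ioi ‖x‖)
      (fun s => 2 * s * Real.exp (-s ^ 2)) s := by
    intro s x
    by_cases hxs : ‖x‖ < s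
    · rw [Set.indicator_of_mem (by exact hxs)]
      simp only [hh]
      rw [Set.indicator_of_mem (by exact hxs)]
    · rw [Set.indicator_of_notMem (by exact hxs)]
      simp only [hh]
      rw [Set.indicator_of_notMem (by exact hxs), mul_zero]
  have hball : ∀ (ψ : EuclideanSpace ℝ (Fin d) → ℝ), Continuous ψ → ∀ s,
      IntegrableOn ψ (Metric.ball 0 s) := fun ψ hψ s =>
    (hψ.continuousOn.integrableOn_compact (isCompact_closedBall 0 s)).mono_set
      Metric.ball_subset_closedBall
  have habs : ∀ (s : ℝ) x, |φ (s • x)| = |s| ^ k * |φ x| := fun s x => by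
    rw [hk, abs_mul, abs_pow]
  have hint : Integrable (Function.uncurry h)
      (volume.prod (volume.restrict (Set.Ioi (0 : ℝ)))) := by
    have hm : AEStronglyMeasurable (Function.uncurry h)
        (volume.prod (volume.restrict (Set.Ioi (0 : ℝ)))) := by
      have : Function.uncurry h = Set.indicator {p : EuclideanSpace ℝ (Fin d) × ℝ | ‖p.1‖ < p.2}
        (fun p => φ p.1 * (2 * p.2 * Real.exp (-p.2 ^ 2))) := by
        ext ⟨x, s⟩; rfl
      rw [this]
      exact (Continuous.aestronglyMeasurable (by fun_prop)).indicator hS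
    rw [integrable_prod_iff' hm]
    constructor
    · refine Filter.Eventually.of_forall fun s => ?_
      simp only [Function.uncurry_apply_pair, hx]
      exact ((integrable_indicator_iff measurableSet_ball).2 (hball φ hφ s)).mul_const _
    · have e : ∀ s ∈ Set.Ioi (0 : ℝ), (2 * ∫ x in Metric.ball 0 1, |φ x|) *
          (s ^ (k + d + 1) * Real.exp (-s ^ 2)) = ∫ x, ‖Function.uncurry h (x, s)‖ := by
        intro s hs0
        have hs0' : (0 : ℝ) < s := hs0
        simp only [Function.uncurry_apply_pair, hx, norm_mul, norm_indicator_eq_indicator_norm]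
        rw [integral_mul_const, integral_indicator measurableSet_ball]
        have := Measure.setIntegral_comp_smul_of_pos volume (fun x => |φ x|) (Metric.ball 0 1) hs0'
        simp only [habs] at this
        rw [integral_const_mul, smul_unitBall_of_pos hs0', finrank_euclideanSpace_fin, smul_eq_mul,
          abs_of_pos hs0'] at this
        have hsd : s ^ d ≠ 0 := by positivity
        have e2 : ∫ x in Metric.ball 0 s, |φ x| = s ^ (k + d) * ∫ x in Metric.ball 0 1, |φ x| := by
          rw [pow_add, mul_right_comm, this]
          field_simp
        simp only [Real.norm_eq_abs, e2, abs_of_pos hs0', abs_two, Real.abs_exp]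
        ring
      have hi : IntegrableOn (fun s : ℝ => (2 * ∫ x in Metric.ball 0 1, |φ x|) *
          (s ^ (k + d + 1) * Real.exp (-s ^ 2))) (Set.Ioi 0) :=
        (integrableOn_Ioi_pow_mul_exp_neg_sq (k + d + 1)).const_mul _
      exact hi.congr_fun e measurableSet_Ioi
  have swap := integral_integral_swap hint
  have lhs : ∀ x, ∫ s in Set.Ioi (0 : ℝ), h x s = φ x * Real.exp (-‖x‖ ^ 2) := by
    intro x
    simp only [hs]
    rw [integral_const_mul, setIntegral_indicator measurableSet_Ioi, Set.Ioi_inter_Ioi,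
      max_eq_right (norm_nonneg x), integral_Ioi_mul_exp_neg_sq (norm_nonneg x)]
  have rhs : ∫ s in Set.Ioi (0 : ℝ), ∫ x, h x s = ∫ s in Set.Ioi (0 : ℝ),
      (2 * ∫ x in Metric.ball 0 1, φ x) * (s ^ (k + d + 1) * Real.exp (-s ^ 2)) := by
    refine setIntegral_congr_fun measurableSet_Ioi fun s hs0 => ?_
    simp only [hx]
    rw [integral_mul_const, integral_indicator measurableSet_ball,
      setIntegral_ball_of_homogeneous hk hs0]
    ring
  simp only [lhs] at swap
  rw [swap, rhs, integral_const_mul, integral_Ioi_pow_mul_exp_neg_sq]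
  push_cast
  rw [show ((k : ℝ) + d + 1 + 1) / 2 = (k + d) / 2 + 1 by ring]
  ring

theorem integral_pow_even_mul_exp_neg_sq (n : ℕ) :
    ∫ t : ℝ, t ^ (2 * n) * Real.exp (-t ^ 2) = Real.Gamma (n + 1 / 2) := by
  have := integral_comp_abs (f := fun t => t ^ (2 * n) * Real.exp (-t ^ 2))
  simp only [pow_mul, sq_abs] at this
  simp only [← pow_mul] at this
  rw [this, integral_Ioi_pow_mul_exp_neg_sq]
  push_cast
  rw [show ((2 : ℝ) * n + 1) / 2 = n + 1 / 2 by ring]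
  ring

/-- In an orthonormal basis whose first vector points along y, the integral factors into
one-dimensional Gaussian moments. -/
theorem integral_inner_pow_mul_exp_neg_norm_sq {d : ℕ} [NeZero d] (y : EuclideanSpace ℝ (Fin d))
    (n : ℕ) :
    ∫ x, inner ℝ y x ^ (2 * n) * Real.exp (-‖x‖ ^ 2) =
      ‖y‖ ^ (2 * n) * (Real.Gamma (n + 1 / 2) * √Real.pi ^ (d - 1)) := by
  obtain ⟨v, hv, hvy⟩ : ∃ v : EuclideanSpace ℝ (Fin d), ‖v‖ = 1 ∧ y = ‖y‖ • v := by
    by_cases hy : y = 0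
    · exact ⟨EuclideanSpace.single 0 1, by simp, by simp [hy]⟩
    · have : ‖y‖ ≠ 0 := norm_ne_zero_iff.2 hy
      exact ⟨‖y‖⁻¹ • y, by rw [norm_smul]; simp [this], by rw [smul_smul]; simp [this]⟩
  obtain ⟨b, hb⟩ := Orthonormal.exists_orthonormalBasis_extension_of_card_eq (𝕜 := ℝ)
    (ι := Fin d) (E := EuclideanSpace ℝ (Fin d)) (by simp) (v := fun _ => v)
    (s := {0}) ⟨fun i => hv, fun i j hij => absurd (Subsingleton.elim i j) hij⟩
  have hb0 : b 0 = v := hb 0 rfl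
  have step : ∀ x, inner ℝ y (b.repr.symm x) ^ (2 * n) * Real.exp (-‖b.repr.symm x‖ ^ 2) =
      ‖y‖ ^ (2 * n) * ∏ i, ((if i = 0 then x i ^ (2 * n) else 1) * Real.exp (-x i ^ 2)) := by
    intro x
    have h1 : inner ℝ y (b.repr.symm x) = ‖y‖ * x 0 := by
      conv_lhs => rw [hvy]
      rw [inner_smul_left, ← hb0, ← b.repr_apply_apply]
      simp
    rw [h1, LinearIsometryEquiv.norm_map, EuclideanSpace.norm_sq_eq, Finset.prod_mul_distrib,
      ← Real.exp_sum, Finset.sum_neg_distrib]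
    simp
    ring
  rw [← b.measurePreserving_repr_symm.integral_comp
    b.repr.symm.toHomeomorph.measurableEmbedding]
  simp only [step]
  rw [integral_const_mul, ← (PiLp.volume_preserving_toLp (Fin d)).integral_comp
    (MeasurableEquiv.toLp 2 _).measurableEmbedding]
  rw [integral_fintype_prod_volume_eq_prod (𝕜 := ℝ) (f := fun (i : Fin d) (t : ℝ) =>
    (if i = 0 then t ^ (2 * n) else 1) * Real.exp (-t ^ 2))]
  have hi : ∀ i : Fin d, ∫ t : ℝ, (if i = 0 then t ^ (2 * n) else 1) * Real.exp (-t ^ 2) =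
      if i = 0 then Real.Gamma (n + 1 / 2) else √Real.pi := by
    intro i
    split_ifs with h
    · exact integral_pow_even_mul_exp_neg_sq n
    · have := integral_pow_even_mul_exp_neg_sq 0
      simpa [← one_div, Real.Gamma_one_half_eq] using this
  simp only [hi]
  rw [Finset.prod_ite]
  simp [Finset.filter_eq', Finset.filter_ne', Finset.card_erase_of_mem]

theorem Gamma_nat_add_half_mul (n : ℕ) :
    Real.Gamma (n + 1 / 2) * (4 ^ n * n.factorial) = (2 * n).factorial * √Real.pi := by
  induction n with
  | zero => simpa using Real.Gamma_one_half_eq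
  | succ n ih =>
    have h0 : (n + 1 / 2 : ℝ) ≠ 0 := by positivity
    rw [show ((n + 1 : ℕ) : ℝ) + 1 / 2 = (n + 1 / 2) + 1 by push_cast; ring,
      Real.Gamma_add_one h0, show 2 * (n + 1) = 2 * n + 1 + 1 by ring, Nat.factorial_succ,
      Nat.factorial_succ, Nat.factorial_succ]
    push_cast
    linear_combination (4 * (n + 1 / 2) * (n + 1)) * ih

/-- The volume of the ball of radius `r` in `ℝ^d`. -/
noncomputable def ballVolume (d : ℕ) (r : ℝ) : ℝ :=
  r ^ d * √Real.pi ^ d / Real.Gamma ((d : ℝ) / 2 + 1)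

theorem volume_real_ball {d : ℕ} [NeZero d] {r : ℝ} (hr : 0 ≤ r) :
    volume.real (Metric.ball (0 : EuclideanSpace ℝ (Fin d)) r) = ballVolume d r := by
  have : 0 < Real.Gamma ((d : ℝ) / 2 + 1) := Real.Gamma_pos_of_pos (by positivity)
  rw [Measure.real, EuclideanSpace.volume_ball, ENNReal.toReal_mul, ENNReal.toReal_pow,
    ENNReal.toReal_ofReal hr, ENNReal.toReal_ofReal (by rw [Fintype.card_fin]; positivity),
    ballVolume, Fintype.card_fin, mul_div_assoc]

theorem setIntegral_ball_inner_pow {d : ℕ} [NeZero d] {r : ℝ} (hr : 0 < r)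
    (y : EuclideanSpace ℝ (Fin d)) (n : ℕ) :
    ∫ x in Metric.ball 0 r, inner ℝ y x ^ (2 * n) =
      r ^ (2 * n + d) * (‖y‖ ^ (2 * n) * (Real.Gamma (n + 1 / 2) * √Real.pi ^ (d - 1))) /
        Real.Gamma ((d : ℝ) / 2 + n + 1) := by
  have hk : ∀ (s : ℝ) x, inner ℝ y (s • x) ^ (2 * n) = s ^ (2 * n) * inner ℝ y x ^ (2 * n) :=
    fun s x => by rw [inner_smul_right, mul_pow]
  have h := integral_mul_exp_neg_norm_sq_of_homogeneous (d := d) (k := 2 * n)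
    (φ := fun x => inner ℝ y x ^ (2 * n)) (by fun_prop) hk
  rw [integral_inner_pow_mul_exp_neg_norm_sq] at h
  have hG : Real.Gamma ((d : ℝ) / 2 + n + 1) ≠ 0 := (Real.Gamma_pos_of_pos (by positivity)).ne'
  rw [show ((2 * n + d : ℕ) : ℝ) / 2 + 1 = (d : ℝ) / 2 + n + 1 by push_cast; ring] at h
  rw [setIntegral_ball_of_homogeneous (φ := fun x => inner ℝ y x ^ (2 * n)) hk hr, h]
  field_simp

/-- The Fourier transform of the indicator function of a ball. -/
theorem setIntegral_ball_cos {d : ℕ} [NeZero d] {r : ℝ} (hr : 0 < r)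
    (y : EuclideanSpace ℝ (Fin d)) :
    ∫ x in Metric.ball 0 r, Real.cos (2 * Real.pi * inner ℝ y x) =
      ballVolume d r * normBessel ((d : ℝ) / 2) ((Real.pi * r * ‖y‖) ^ 2) := by
  set R : ℝ := 2 * Real.pi * (‖y‖ * r)
  have hterm : ∀ n : ℕ, ∫ x in Metric.ball (0 : EuclideanSpace ℝ (Fin d)) r,
      (-1 : ℝ) ^ n * (2 * Real.pi * inner ℝ y x) ^ (2 * n) / (2 * n).factorial =
      ballVolume d r *
        (normBesselCoeff ((d : ℝ) / 2) n * ((Real.pi * r * ‖y‖) ^ 2) ^ n) := by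
    intro n
    have : ∀ x : EuclideanSpace ℝ (Fin d),
        (-1 : ℝ) ^ n * (2 * Real.pi * inner ℝ y x) ^ (2 * n) / (2 * n).factorial =
        (-1 : ℝ) ^ n * (2 * Real.pi) ^ (2 * n) / (2 * n).factorial * inner ℝ y x ^ (2 * n) := by
      intro x; rw [mul_pow _ (inner ℝ y x)]; ring
    simp only [this]
    rw [integral_const_mul, setIntegral_ball_inner_pow hr, ballVolume, normBesselCoeff]
    have g1 : Real.Gamma ((d : ℝ) / 2 + n + 1) ≠ 0 := (Real.Gamma_pos_of_pos (by positivity)).ne'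
    have g2 : Real.Gamma ((d : ℝ) / 2 + 1) ≠ 0 := (Real.Gamma_pos_of_pos (by positivity)).ne'
    have f1 : ((2 * n).factorial : ℝ) ≠ 0 := by positivity
    have f2 : (n.factorial : ℝ) ≠ 0 := by positivity
    have hpi : √Real.pi ^ d = √Real.pi ^ (d - 1) * √Real.pi := by
      rw [← pow_succ, Nat.sub_add_cancel NeZero.one_le]
    have hg := Gamma_nat_add_half_mul n
    have h4 : (2 : ℝ) ^ (2 * n) = 4 ^ n := by rw [pow_mul]; norm_num
    rw [hpi, mul_pow 2 Real.pi, h4, ← pow_mul, mul_pow (Real.pi * r), mul_pow Real.pi r, pow_add]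
    generalize Real.Gamma (n + 1 / 2) = G at hg ⊢
    field_simp
    linear_combination ‖y‖ ^ (2 * n) * hg
  -- The cosine series is integrated term by term; on the ball `R` bounds |2π⟨y, x⟩|, so its terms
  -- are dominated by those of an exponential series.
  have key := hasSum_integral_of_dominated_convergence
    (μ := volume.restrict (Metric.ball (0 : EuclideanSpace ℝ (Fin d)) r))
    (F := fun (n : ℕ) x => (-1 : ℝ) ^ n * (2 * Real.pi * inner ℝ y x) ^ (2 * n) /
      (2 * n).factorial) (f := fun x => Real.cos (2 * Real.pi * inner ℝ y x))
    (fun n _ => R ^ (2 * n) / (2 * n).factorial)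
    (fun n => Continuous.aestronglyMeasurable (by fun_prop))
    (fun n => (ae_restrict_iff' measurableSet_ball).2 (Filter.Eventually.of_forall fun x hx => by
      have hxr : ‖x‖ ≤ r := (mem_ball_zero_iff.1 hx).le
      have h1 : |inner ℝ y x| ≤ ‖y‖ * r :=
        (abs_real_inner_le_norm y x).trans (by gcongr)
      rw [Real.norm_eq_abs, abs_div, abs_mul, abs_pow, abs_neg, abs_one, one_pow, one_mul,
        abs_pow, abs_mul, abs_of_pos Real.two_pi_pos, Nat.abs_cast]
      simp only [R]
      gcongr))
    (Filter.Eventually.of_forall fun x =>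
      (Real.summable_pow_div_factorial R).comp_injective
        (mul_right_injective₀ (two_ne_zero : (2 : ℕ) ≠ 0)))
    (by
      have : IsFiniteMeasure (volume.restrict (Metric.ball (0 : EuclideanSpace ℝ (Fin d)) r)) :=
        ⟨by rw [Measure.restrict_apply_univ]; exact measure_ball_lt_top⟩
      exact integrable_const _)
    (Filter.Eventually.of_forall fun x => Real.hasSum_cos _)
  simp only [hterm] at key
  have s := (summable_normBessel (ν := (d : ℝ) / 2) (by positivity)
    ((Real.pi * r * ‖y‖) ^ 2)).hasSum.mul_left (ballVolume d r)
  exact key.unique s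

/-! ### Estimates for λ_d -/

theorem besselRatio_eq_normBessel (d : ℕ) {u : ℝ} (hu : 0 < u) :
    besselRatio d u = normBessel ((d : ℝ) / 2) (u ^ 2 / 4) := by
  have h : (u / 2) ^ ((d : ℝ) / 2) ≠ 0 := (Real.rpow_pos_of_pos (by positivity) _).ne'
  rw [besselRatio, besselJ, mul_left_comm, mul_div_cancel_left₀ _ h, normBessel, ← tsum_mul_left]
  refine tsum_congr fun n => ?_
  rw [normBesselCoeff, pow_mul, show (u / 2) ^ 2 = u ^ 2 / 4 by ring]
  ring

theorem image_besselRatio (d : ℕ) :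
    besselRatio d '' Set.Ioi 0 = normBessel ((d : ℝ) / 2) '' Set.Ioi 0 := by
  ext t
  constructor
  · rintro ⟨u, hu, rfl⟩
    have hu' : (0 : ℝ) < u := hu
    exact ⟨u ^ 2 / 4, by simp only [Set.mem_Ioi]; positivity,
      (besselRatio_eq_normBessel d hu').symm⟩
  · rintro ⟨z, hz, rfl⟩
    have hz' : (0 : ℝ) < z := hz
    refine ⟨2 * √z, by simp only [Set.mem_Ioi]; positivity, ?_⟩
    rw [besselRatio_eq_normBessel d (by positivity), mul_pow, Real.sq_sqrt hz'.le]
    congr 1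
    ring

/-- Real `sInf` is 0 on sets unbounded below, so this is what makes `besselLambda` a genuine
infimum. -/
theorem bddBelow_besselRatio (d : ℕ) : BddBelow (besselRatio d '' Set.Ioi 0) := by
  rw [image_besselRatio]
  refine ⟨-1, ?_⟩
  rintro _ ⟨z, hz, rfl⟩
  exact (abs_le.1 (abs_normBessel_le_one (by positivity) (le_of_lt hz))).1

theorem neg_besselLambda_le (d : ℕ) {z : ℝ} (hz : 0 ≤ z) :
    -besselLambda d ≤ normBessel ((d : ℝ) / 2) z := by
  have hpos : ∀ z : ℝ, 0 < z → -besselLambda d ≤ normBessel ((d : ℝ) / 2) z := by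
    intro z hz
    rw [besselLambda, neg_neg]
    refine csInf_le (bddBelow_besselRatio d) ?_
    rw [image_besselRatio]
    exact ⟨z, hz, rfl⟩
  rcases hz.eq_or_lt with rfl | hz
  · rw [normBessel_zero (by positivity)]
    exact (hpos 1 one_pos).trans
      (abs_le.1 (abs_normBessel_le_one (by positivity) zero_le_one)).2
  · exact hpos z hz

/-- If F_{d/2} stayed above some c > 0, then F_{d/2-1}, whose derivative is -F_{d/2}/(d/2), would
decrease at least linearly without bound, contradicting |F_{d/2-1}| ≤ 1. Lowering the index needs d
≥ 2. -/
theorem besselLambda_nonneg {d : ℕ} (hd : 2 ≤ d) : 0 ≤ besselLambda d := by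
  by_contra! h
  have hd' : (2 : ℝ) ≤ d := by exact_mod_cast hd
  set c := -besselLambda d
  have hc : 0 < c := by simp only [c]; linarith
  set ν : ℝ := (d : ℝ) / 2 - 1 with hν
  have hν0 : 0 ≤ ν := by linarith
  -- At this point the linear upper bound equals 1 - 3 = -2.
  have hz : 0 ≤ 3 * (ν + 1) / c := by positivity
  have := le_of_hasDerivAt_le_of_nonneg (f := normBessel ν)
    (g := fun z => 1 - z * (c / (ν + 1))) (g' := fun _ => -(1 * (c / (ν + 1)))) hz
    (hasDerivAt_normBessel hν0)
    (fun y => ((hasDerivAt_id' y).mul_const _).const_sub 1) (by simp [normBessel_zero hν0])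
    fun x hx _ => by
      have := neg_besselLambda_le d hx
      rw [show (d : ℝ) / 2 = ν + 1 by rw [hν]; ring] at this
      rw [one_mul, neg_div, neg_le_neg_iff]
      gcongr
  have h1 := (abs_le.1 (abs_normBessel_le_one hν0 hz)).1
  have e : 3 * (ν + 1) / c * (c / (ν + 1)) = 3 := by field_simp
  rw [e] at this
  linarith

/-- Up to a the function is positive; beyond a its square is at most the energy at a. -/
theorem besselLambda_le_of_energy_le {d : ℕ} {a c : ℝ} (ha : 0 ≤ a) (hc : 0 ≤ c)
    (hpos : ∀ z, 0 ≤ z → z ≤ a → 0 < normBessel ((d : ℝ) / 2) z)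
    (henergy : normBessel ((d : ℝ) / 2) a ^ 2 +
      a * (normBessel ((d : ℝ) / 2 + 1) a / ((d : ℝ) / 2 + 1)) ^ 2 ≤ c ^ 2) :
    besselLambda d ≤ c := by
  rw [besselLambda, neg_le, image_besselRatio]
  refine le_csInf ⟨_, 1, Set.mem_Ioi.2 one_pos, rfl⟩ ?_
  rintro _ ⟨z, hz, rfl⟩
  have hz' : (0 : ℝ) < z := hz
  rcases le_total z a with h | h
  · linarith [hpos z hz'.le h]
  · exact (abs_le.1 (abs_le_of_sq_le_sq
      ((normBessel_sq_le (by positivity) ha h).trans henergy) hc)).1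

theorem besselLambda_lt_half {d : ℕ} (hd : 2 ≤ d) : besselLambda d < 1 / 2 := by
  have hd' : (2 : ℝ) ≤ d := by exact_mod_cast hd
  refine lt_of_le_of_lt (b := 2 / 5) ?_ (by norm_num)
  set ν : ℝ := (d : ℝ) / 2 with hν
  have hν1 : 1 ≤ ν := by linarith
  have hν0 : 0 ≤ ν := by linarith
  have h0 : 0 ≤ 3 / 2 * (ν + 1) := by positivity
  refine besselLambda_le_of_energy_le (a := 3 / 2 * (ν + 1)) h0 (by norm_num)
    (fun z hz hza => normBessel_pos_of_le_mul hν1 hz hza) ?_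
  rw [← hν]
  have p0 := normBessel_pos_of_le_mul hν1 h0 le_rfl
  have p1 := normBessel_pos_of_le_mul (ν := ν + 1) (z := 3 / 2 * (ν + 1)) (by linarith) h0
    (by linarith)
  have b0 := normBessel_le_exp hν0 h0 fun x hx hxz =>
    (normBessel_pos_of_le_mul (ν := ν + 2) (by linarith) hx (by linarith)).le
  have b1 := normBessel_le_exp (ν := ν + 1) (by linarith) h0 fun x hx hxz =>
    (normBessel_pos_of_le_mul (ν := ν + 1 + 2) (by linarith) hx (by linarith)).le
  -- With exp(-1) < 0.37 the energy at a is at most 0.37³ + (3/4)·0.37² < 0.16 = (2/5)².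
  have e1 : Real.exp (-1) < 37 / 100 := lt_trans Real.exp_neg_one_lt_d9 (by norm_num)
  have b1' : normBessel (ν + 1) (3 / 2 * (ν + 1)) ≤ 37 / 100 := by
    refine b1.trans (le_trans (Real.exp_le_exp.2 ?_) e1.le)
    rw [div_le_iff₀ (by positivity)]
    linarith
  have b0' : normBessel ν (3 / 2 * (ν + 1)) ^ 2 ≤ (37 / 100) ^ 3 := by
    calc _ ≤ Real.exp (-(3 / 2 * (ν + 1)) / (ν + 1)) ^ 2 := by gcongr
      _ = Real.exp (-1) ^ 3 := by
        rw [← Real.exp_nat_mul, ← Real.exp_nat_mul]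
        congr 1
        push_cast
        field_simp
      _ ≤ _ := by gcongr
  have b2 : 3 / 2 * (ν + 1) * (normBessel (ν + 1) (3 / 2 * (ν + 1)) / (ν + 1)) ^ 2 ≤
      3 / 4 * (37 / 100) ^ 2 := by
    have e : 3 / 2 * (ν + 1) * (normBessel (ν + 1) (3 / 2 * (ν + 1)) / (ν + 1)) ^ 2 =
      (3 / 2 / (ν + 1)) * normBessel (ν + 1) (3 / 2 * (ν + 1)) ^ 2 := by field_simp
    rw [e]
    have : 3 / 2 / (ν + 1) ≤ 3 / 4 := by
      rw [div_le_iff₀ (by positivity)]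
      linarith
    gcongr
  linarith

theorem besselLambda_le_exp (d : ℕ) : besselLambda d ≤ 2 * Real.exp (-1 / 8) ^ d := by
  set ν : ℝ := (d : ℝ) / 2 with hν
  have hν0 : 0 ≤ ν := by positivity
  have h0 : 0 ≤ (ν + 1) ^ 2 / 4 := by positivity
  have hexp : Real.exp (-1 / 8) ^ d = Real.exp (-ν / 4) := by
    rw [← Real.exp_nat_mul, hν]
    congr 1
    ring
  rw [hexp]
  refine besselLambda_le_of_energy_le (a := (ν + 1) ^ 2 / 4) h0 (by positivity)
    (fun z hz hza => normBessel_pos hν0 hz hza) ?_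
  rw [← hν]
  have mono : ∀ {μ : ℝ}, ν ≤ μ → ∀ x, 0 ≤ x → x ≤ (ν + 1) ^ 2 / 4 → 0 ≤ normBessel μ x :=
    fun {μ} hμ x hx hxz => (normBessel_pos (by linarith) hx (hxz.trans (by gcongr))).le
  have b0 := normBessel_le_exp hν0 h0 (mono (by linarith))
  have b1 := normBessel_le_exp (ν := ν + 1) (by linarith) h0 (mono (by linarith))
  have p0 := mono le_rfl _ h0 le_rfl
  have p1 := mono (by linarith : ν ≤ ν + 1) _ h0 le_rfl
  have c0 : normBessel ν ((ν + 1) ^ 2 / 4) ≤ Real.exp (-ν / 4) := by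
    refine b0.trans (Real.exp_le_exp.2 ?_)
    rw [div_le_iff₀ (by positivity)]
    nlinarith
  have c1 : normBessel (ν + 1) ((ν + 1) ^ 2 / 4) ≤ Real.exp (-ν / 4) := by
    refine b1.trans (Real.exp_le_exp.2 ?_)
    rw [div_le_iff₀ (by positivity)]
    nlinarith
  -- At a = (ν + 1)²/4 the factor z cancels (ν + 1)², so the energy is at most (5/4) exp(-ν/4)²,
  -- well within (2 exp(-ν/4))².
  have e : (ν + 1) ^ 2 / 4 * (normBessel (ν + 1) ((ν + 1) ^ 2 / 4) / (ν + 1)) ^ 2 =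
      normBessel (ν + 1) ((ν + 1) ^ 2 / 4) ^ 2 / 4 := by field_simp
  rw [e]
  have d0 : normBessel ν ((ν + 1) ^ 2 / 4) ^ 2 ≤ Real.exp (-ν / 4) ^ 2 := by gcongr
  have d1 : normBessel (ν + 1) ((ν + 1) ^ 2 / 4) ^ 2 ≤ Real.exp (-ν / 4) ^ 2 := by gcongr
  have : 0 ≤ Real.exp (-ν / 4) ^ 2 := sq_nonneg _
  nlinarith

/-! ### The uncertainty inequality -/

section

variable {d : ℕ}

theorem fourierR_eq_integral_cos {f : EuclideanSpace ℝ (Fin d) → ℝ} (hf : Integrable f)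
    (y : EuclideanSpace ℝ (Fin d)) :
    fourierR f y = ∫ x, f x * Real.cos (2 * Real.pi * inner ℝ x y) := by
  have hi : Integrable fun x => Real.fourierChar (-inner ℝ x y) • (f x : ℂ) :=
    (Real.fourierIntegral_convergent_iff y).2 hf.ofReal
  rw [fourierR, fourierC, Real.fourier_eq, ← RCLike.re_eq_complex_re, ← integral_re hi]
  refine integral_congr_ae (Filter.Eventually.of_forall fun x => ?_)
  simp only [RCLike.re_eq_complex_re, Circle.smul_def, smul_eq_mul, Real.fourierChar_apply]
  rw [Complex.re_mul_ofReal, Complex.exp_ofReal_mul_I_re, mul_comm, mul_neg, Real.cos_neg]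

theorem eq_integral_fourierR_mul_cos {f : EuclideanSpace ℝ (Fin d) → ℝ} (hc : Continuous f)
    (hr : IsRadial f) (hf : Integrable f) (hf' : Integrable (fourierC f))
    (x : EuclideanSpace ℝ (Fin d)) :
    f x = ∫ y, fourierR f y * Real.cos (2 * Real.pi * inner ℝ x y) := by
  have hinv : 𝓕⁻ (fourierC f) x = (f x : ℂ) :=
    congrFun (Continuous.fourierInv_fourier_eq (by fun_prop) hf.ofReal hf') x
  have hR : Integrable (fourierR f) := hf'.re
  -- The inverse transform is the transform at -x; the sign disappears in the cosine.
  have hneg : 𝓕⁻ (fourierC f) x = 𝓕 (fun y => (fourierR f y : ℂ)) (-x) := by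
    rw [← Real.fourierInv_eq_fourier_neg]
    exact congrArg (fun u : EuclideanSpace ℝ (Fin d) → ℂ => 𝓕⁻ u x) (funext fun y => fourierC_eq_ofReal hr y)
  have := fourierR_eq_integral_cos hR (-x)
  rw [fourierR, fourierC, ← hneg, hinv, Complex.ofReal_re] at this
  rw [this]
  refine integral_congr_ae (Filter.Eventually.of_forall fun y => ?_)
  simp only [inner_neg_right, mul_neg, Real.cos_neg, real_inner_comm]

theorem continuous_fourierR {f : EuclideanSpace ℝ (Fin d) → ℝ} (hf : Integrable f) :
    Continuous (fourierR f) :=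
  Complex.continuous_re.comp
    (VectorFourier.fourierIntegral_continuous Real.continuous_fourierChar
      (by exact continuous_inner) hf.ofReal)

theorem integral_abs_eq_add_negPart {α : Type*} [MeasurableSpace α] {μ : Measure α} {f : α → ℝ}
    (hf : Integrable f μ) :
    ∫ x, |f x| ∂μ = ∫ x, f x ∂μ + 2 * ∫ x, max (-f x) 0 ∂μ := by
  have hn : Integrable (fun x => 2 * max (-f x) 0) μ := hf.neg.pos_part.const_mul 2
  rw [← integral_const_mul, ← integral_add hf hn]
  refine integral_congr_ae (Filter.Eventually.of_forall fun x => ?_)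
  dsimp only
  rcases le_total 0 (f x) with h | h
  · rw [abs_of_nonneg h, max_eq_right (by linarith)]; ring
  · rw [abs_of_nonpos h, max_eq_left (by linarith)]; ring

/-- If the negative part had no mass, ∫ |f| = ∫ f + 2∫ f⁻ would be at most 0, and continuity would
give f = 0. Positivity is what allows the masses to be cancelled at the end. -/
theorem integral_negPart_pos {f : EuclideanSpace ℝ (Fin d) → ℝ} (hc : Continuous f)
    (hf : Integrable f) (h0 : f ≠ 0) (hle : ∫ x, f x ≤ 0) : 0 < ∫ x, max (-f x) 0 := by
  by_contra! h
  have h1 := integral_abs_eq_add_negPart hf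
  have h2 : ∫ x, |f x| = 0 :=
    le_antisymm (by linarith) (integral_nonneg fun x => abs_nonneg _)
  rw [integral_eq_zero_iff_of_nonneg (fun x => abs_nonneg _) hf.abs] at h2
  have h3 : (fun x => |f x|) = 0 :=
    Continuous.ae_eq_iff_eq volume (by fun_prop) continuous_const |>.1 h2
  exact h0 (funext fun x => abs_eq_zero.1 (congrFun h3 x))

theorem setIntegral_cos_le {S : Set (EuclideanSpace ℝ (Fin d))} (hfin : volume S ≠ ∞)
    (y : EuclideanSpace ℝ (Fin d)) :
    ∫ x in S, Real.cos (2 * Real.pi * inner ℝ y x) ≤ volume.real S := by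
  have := norm_setIntegral_le_of_norm_le_const (μ := volume) (s := S) (C := 1)
    (f := fun x => Real.cos (2 * Real.pi * inner ℝ y x)) hfin.lt_top
    fun x _ => Real.abs_cos_le_one _
  rw [one_mul] at this
  exact (le_abs_self _).trans this

theorem integrableOn_cos {S : Set (EuclideanSpace ℝ (Fin d))} (hfin : volume S ≠ ∞)
    (y : EuclideanSpace ℝ (Fin d)) :
    IntegrableOn (fun x => Real.cos (2 * Real.pi * inner ℝ y x)) S :=
  IntegrableOn.of_bound hfin.lt_top (Continuous.aestronglyMeasurable (by fun_prop)) 1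
    (Filter.Eventually.of_forall fun _ => Real.abs_cos_le_one _)

theorem ballVolume_pos {r : ℝ} (hr : 0 < r) : 0 < ballVolume d r := by
  have : 0 < Real.Gamma ((d : ℝ) / 2 + 1) := Real.Gamma_pos_of_pos (by positivity)
  have := Real.pi_pos
  unfold ballVolume
  positivity

/-- Split off the complement of S in the ball: its transform is at most its volume, and that of the
ball is at least -λ_d times the volume of the ball. -/
theorem neg_setIntegral_cos_le [NeZero d] {S : Set (EuclideanSpace ℝ (Fin d))}
    (hS : MeasurableSet S) {r : ℝ} (hr : 0 < r) (hSr : S ⊆ Metric.ball 0 r)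
    (y : EuclideanSpace ℝ (Fin d)) :
    -∫ x in S, Real.cos (2 * Real.pi * inner ℝ y x) ≤
      (1 + besselLambda d) * ballVolume d r - volume.real S := by
  have hB : volume (Metric.ball (0 : EuclideanSpace ℝ (Fin d)) r) ≠ ∞ := measure_ball_lt_top.ne
  have hD : volume (Metric.ball (0 : EuclideanSpace ℝ (Fin d)) r \ S) ≠ ∞ :=
    measure_ne_top_of_subset Set.sdiff_subset hB
  have h1 := setIntegral_sdiff hS (integrableOn_cos hB y) hSr
  have h2 := setIntegral_cos_le hD y
  have h3 : volume.real (Metric.ball (0 : EuclideanSpace ℝ (Fin d)) r \ S) =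
      ballVolume d r - volume.real S := by
    rw [measureReal_sdiff hSr hS hB, volume_real_ball hr.le]
  rw [h1, h3, setIntegral_ball_cos hr] at h2
  have h4 := mul_le_mul_of_nonneg_left
    (neg_besselLambda_le d (sq_nonneg (Real.pi * r * ‖y‖))) (ballVolume_pos (d := d) hr).le
  linarith

/-- If `f` is the cosine transform of `h`, if `f(0) ≤ 0` and `f` is nonnegative outside a ball,
then the mass of the negative part of `f` is controlled by that of `h`. -/
theorem integral_negPart_le (hd : 2 ≤ d) {f h : EuclideanSpace ℝ (Fin d) → ℝ} (hc : Continuous f)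
    (hh : Integrable h) (hf0 : f 0 ≤ 0)
    (heq : ∀ x, f x = ∫ y, h y * Real.cos (2 * Real.pi * inner ℝ x y))
    {r : ℝ} (hr : 0 < r) (hfr : ∀ x, r < ‖x‖ → 0 ≤ f x) :
    ∫ x, max (-f x) 0 ≤ (1 + besselLambda d) * ballVolume d r * ∫ y, max (-h y) 0 := by
  have : NeZero d := ⟨by omega⟩
  set S : Set (EuclideanSpace ℝ (Fin d)) := {x | f x < 0} with hSdef
  have hSo : IsOpen S := isOpen_lt hc continuous_const
  -- The sign condition only puts S in the closed ball; S is open, hence in the interior.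
  have hSr : S ⊆ Metric.ball 0 r := by
    rw [← interior_closedBall _ hr.ne']
    refine interior_maximal (fun x hx => ?_) hSo
    by_contra hx'
    exact absurd (hfr x (by simpa using hx')) (not_le.2 hx)
  have hfin : volume S ≠ ∞ := measure_ne_top_of_subset hSr measure_ball_lt_top.ne
  have hle : volume.real S ≤ ballVolume d r := by
    rw [← volume_real_ball hr.le]
    exact measureReal_mono hSr measure_ball_lt_top.ne
  have : IsFiniteMeasure (volume.restrict S) :=
    ⟨by rw [Measure.restrict_apply_univ]; exact hfin.lt_top⟩
  have e1 : ∫ x, max (-f x) 0 = -∫ x in S, f x := by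
    rw [← integral_neg, ← integral_indicator hSo.measurableSet]
    congr 1
    ext x
    by_cases hx : x ∈ S
    · rw [Set.indicator_of_mem hx, max_eq_left (by linarith [show f x < 0 from hx])]
    · rw [Set.indicator_of_notMem hx, max_eq_right (by linarith [show 0 ≤ f x from not_lt.1 hx])]
  have hint : Integrable (Function.uncurry fun x y => h y * Real.cos (2 * Real.pi * inner ℝ x y))
      ((volume.restrict S).prod volume) := by
    have h1 : Integrable (fun p : EuclideanSpace ℝ (Fin d) × EuclideanSpace ℝ (Fin d) => h p.2)
        ((volume.restrict S).prod volume) := hh.comp_snd _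
    refine h1.mul_bdd (c := 1) (Continuous.aestronglyMeasurable (by fun_prop))
      (Filter.Eventually.of_forall fun p => Real.abs_cos_le_one _)
  have e2 : ∫ x in S, f x =
      ∫ y, h y * ∫ x in S, Real.cos (2 * Real.pi * inner ℝ y x) := by
    simp only [heq]
    rw [integral_integral_swap hint]
    refine integral_congr_ae (Filter.Eventually.of_forall fun y => ?_)
    simp only [← integral_const_mul, real_inner_comm]
  have hi : Integrable fun y => h y * ∫ x in S, Real.cos (2 * Real.pi * inner ℝ y x) := by
    refine hint.integral_prod_right.congr (Filter.Eventually.of_forall fun y => ?_)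
    simp only [Function.uncurry_apply_pair, ← integral_const_mul, real_inner_comm]
  have hneg : Integrable fun y => max (-h y) 0 := hh.neg.pos_part
  have hpos : Integrable fun y => max (h y) 0 := hh.pos_part
  -- This is ∫ h = f(0) ≤ 0.
  have hpn : ∫ y, max (h y) 0 ≤ ∫ y, max (-h y) 0 := by
    have : f 0 = ∫ y, (max (h y) 0 - max (-h y) 0) := by
      rw [heq]
      refine integral_congr_ae (Filter.Eventually.of_forall fun y => ?_)
      simp only [inner_zero_left, mul_zero, Real.cos_zero, mul_one]
      exact (max_zero_sub_eq_self (h y)).symm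
    rw [integral_sub hpos hneg] at this
    linarith
  set e := volume.real S
  set K := (1 + besselLambda d) * ballVolume d r
  -- Needed to replace positive mass by negative mass in the last estimate; it relies on λ_d ≥ 0.
  have hK : 0 ≤ K - e := by
    have := mul_nonneg (besselLambda_nonneg hd) (ballVolume_pos (d := d) hr).le
    simp only [K]
    linarith
  calc ∫ x, max (-f x) 0
      = ∫ y, -(h y * ∫ x in S, Real.cos (2 * Real.pi * inner ℝ y x)) := by
        rw [e1, e2, integral_neg]
    _ ≤ ∫ y, (e * max (-h y) 0 + (K - e) * max (h y) 0) := by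
        refine integral_mono hi.neg ((hneg.const_mul _).add (hpos.const_mul _)) fun y => ?_
        have k1 := setIntegral_cos_le hfin y
        have k2 := neg_setIntegral_cos_le hSo.measurableSet hr hSr y
        dsimp only
        rcases le_total 0 (h y) with hy | hy
        · rw [max_eq_left hy, max_eq_right (by linarith : -h y ≤ 0)]
          nlinarith
        · rw [max_eq_right hy, max_eq_left (by linarith : 0 ≤ -h y)]
          nlinarith
    _ = e * (∫ y, max (-h y) 0) + (K - e) * (∫ y, max (h y) 0) := by
        rw [integral_add (hneg.const_mul _) (hpos.const_mul _), integral_const_mul,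
          integral_const_mul]
    _ ≤ e * (∫ y, max (-h y) 0) + (K - e) * (∫ y, max (-h y) 0) := by gcongr
    _ = K * ∫ y, max (-h y) 0 := by ring

/-- Rules out the product 0·∞, which is 0 in `ℝ≥0∞`: arbitrarily small admissible radii would force
N ≤ 0. -/
theorem signRadius_ne_zero (hd : d ≠ 0) {f : EuclideanSpace ℝ (Fin d) → ℝ} {N K : ℝ} (hN : 0 < N)
    (hK : 0 ≤ K) (h : ∀ r : ℝ, 0 < r → (∀ x, r < ‖x‖ → 0 ≤ f x) → N ≤ K * r ^ d) :
    signRadius f ≠ 0 := by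
  intro h0
  have hρ : 0 < min 1 (N / (K + 1)) := by positivity
  have : signRadius f < ENNReal.ofReal (min 1 (N / (K + 1))) := by
    rw [h0]; exact ENNReal.ofReal_pos.2 hρ
  obtain ⟨_, ⟨r, ⟨hr, hfr⟩, rfl⟩, hlt⟩ := sInf_lt_iff.1 this
  rw [ENNReal.ofReal_lt_ofReal_iff hρ] at hlt
  have h1 : r < 1 := hlt.trans_le (min_le_left _ _)
  have h2 : r < N / (K + 1) := hlt.trans_le (min_le_right _ _)
  rw [lt_div_iff₀ (by positivity)] at h2
  have h3 : r ^ d ≤ r := pow_le_of_le_one hr.le h1.le hd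
  nlinarith [h r hr hfr]

theorem le_signRadius_mul_signRadius (hd : 2 ≤ d) {f : EuclideanSpace ℝ (Fin d) → ℝ}
    (hc : Continuous f) (h0 : f ≠ 0) (hrad : IsRadial f) (hf : Integrable f)
    (hf' : Integrable (fourierC f)) (hf0 : f 0 ≤ 0) (hf0' : fourierR f 0 ≤ 0) :
    ENNReal.ofReal ((1 / Real.pi) *
        (1 / (1 + besselLambda d) * Real.Gamma ((d : ℝ) / 2 + 1)) ^ (2 / (d : ℝ)))
      ≤ signRadius f * signRadius (fourierR f) := by
  have hd0 : d ≠ 0 := by omega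
  set g := fourierR f with hg
  have hgc : Continuous g := continuous_fourierR hf
  have hgi : Integrable g := hf'.re
  have hfg : ∀ x, f x = ∫ y, g y * Real.cos (2 * Real.pi * inner ℝ x y) :=
    eq_integral_fourierR_mul_cos hc hrad hf hf'
  have hgf : ∀ x, g x = ∫ y, f y * Real.cos (2 * Real.pi * inner ℝ x y) := fun x => by
    simp only [hg, fourierR_eq_integral_cos hf, real_inner_comm]
  have hg0 : g ≠ 0 := by
    intro h
    exact h0 (funext fun x => by rw [hfg x, h]; simp)
  have hN := integral_negPart_pos hc hf h0 (by simpa [hgf 0] using hf0')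
  have hM := integral_negPart_pos hgc hgi hg0 (by simpa [hfg 0] using hf0)
  have bf := fun {r : ℝ} => integral_negPart_le hd hc hgi hf0 hfg (r := r)
  have bg := fun {r : ℝ} => integral_negPart_le hd hgc hf hf0' hgf (r := r)
  set N := ∫ x, max (-f x) 0
  set M := ∫ x, max (-g x) 0
  set Γd := Real.Gamma ((d : ℝ) / 2 + 1)
  have hΓ : 0 < Γd := Real.Gamma_pos_of_pos (by positivity)
  have hl : 0 < 1 + besselLambda d := by linarith [besselLambda_nonneg hd]
  have hπ := Real.pi_pos
  set κ := (1 + besselLambda d) * (√Real.pi ^ d / Γd) with hκ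
  have hκ0 : 0 < κ := by positivity
  have hκr : ∀ r, (1 + besselLambda d) * ballVolume d r = κ * r ^ d := fun r => by
    rw [ballVolume, hκ]; ring
  simp only [hκr] at bf bg
  have hf1 : signRadius f ≠ 0 :=
    signRadius_ne_zero hd0 hN (K := κ * M) (by positivity) fun r hr hfr => by
      linarith [bf hr hfr]
  have hg1 : signRadius g ≠ 0 :=
    signRadius_ne_zero hd0 hM (K := κ * N) (by positivity) fun r hr hgr => by
      linarith [bg hr hgr]
  -- It suffices to bound products of numbers strictly above the two infima, and below such numbers
  -- lie admissible radii r and s.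
  refine ENNReal.le_mul_of_forall_lt (Or.inl hf1) (Or.inr hg1) fun a ha b hb => ?_
  obtain ⟨_, ⟨r, ⟨hr, hfr⟩, rfl⟩, hra⟩ := sInf_lt_iff.1 ha
  obtain ⟨_, ⟨s, ⟨hs, hgs⟩, rfl⟩, hsb⟩ := sInf_lt_iff.1 hb
  refine le_trans ?_ (mul_le_mul' hra.le hsb.le)
  rw [← ENNReal.ofReal_mul hr.le]
  refine ENNReal.ofReal_le_ofReal ?_
  have h1 : 1 ≤ κ ^ 2 * (r * s) ^ d := by
    -- The two mass inequalities are chained, passing from f to its transform and back.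
    have h2 : N ≤ κ ^ 2 * (r * s) ^ d * N := by
      calc N ≤ κ * r ^ d * M := bf hr hfr
        _ ≤ κ * r ^ d * (κ * s ^ d * N) := by
          gcongr
          exact bg hs hgs
        _ = _ := by rw [mul_pow]; ring
    exact le_of_mul_le_mul_right (by linarith) hN
  refine le_of_pow_le_pow_left₀ hd0 (by positivity) ?_
  have h2 : ((1 / (1 + besselLambda d) * Γd) ^ (2 / (d : ℝ))) ^ d =
      (1 / (1 + besselLambda d) * Γd) ^ 2 := by
    rw [← Real.rpow_natCast, ← Real.rpow_mul (by positivity),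
      div_mul_cancel₀ _ (by exact_mod_cast hd0)]
    norm_cast
  have h3 : κ ^ 2 = (1 + besselLambda d) ^ 2 * Real.pi ^ d / Γd ^ 2 := by
    rw [hκ, mul_pow, div_pow, ← pow_mul, mul_comm d 2, pow_mul, Real.sq_sqrt hπ.le]
    ring
  rw [mul_pow, h2]
  rw [h3] at h1
  calc (1 / Real.pi) ^ d * (1 / (1 + besselLambda d) * Γd) ^ 2
      = 1 / ((1 + besselLambda d) ^ 2 * Real.pi ^ d / Γd ^ 2) := by
        rw [div_pow, one_pow]
        field_simp
    _ ≤ (r * s) ^ d := by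
        rw [div_le_iff₀ (by positivity)]
        linarith

end

theorem theorem1p7 :
    (∀ d : ℕ, 2 ≤ d →
      -- the infimum that defines `λ_d` is finite
      BddBelow (besselRatio d '' Set.Ioi 0) ∧
      ∀ f : EuclideanSpace ℝ (Fin d) → ℝ,
        Continuous f → f ≠ 0 → IsRadial f →
        Integrable f volume → Integrable (fourierC f) volume →
        f 0 ≤ 0 → fourierR f 0 ≤ 0 →
        ENNReal.ofReal ((1 / Real.pi) *
            (1 / (1 + besselLambda d) * Real.Gamma ((d : ℝ) / 2 + 1)) ^ (2 / (d : ℝ)))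
          ≤ signRadius f * signRadius (fourierR f)) ∧
    (∀ d : ℕ, 2 ≤ d → besselLambda d < 1 / 2) ∧
    (∃ C q : ℝ, 0 < q ∧ q < 1 ∧ ∀ d : ℕ, 2 ≤ d → |besselLambda d| ≤ C * q ^ d) := by
  refine ⟨fun d hd => ⟨bddBelow_besselRatio d, fun f hc h0 hrad hf hf' hf0 hf0' =>
    le_signRadius_mul_signRadius hd hc h0 hrad hf hf' hf0 hf0'⟩,
    fun d hd => besselLambda_lt_half hd, 2, Real.exp (-1 / 8), Real.exp_pos _,
    Real.exp_lt_one_iff.2 (by norm_num), fun d hd => ?_⟩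
  rw [abs_of_nonneg (besselLambda_nonneg hd)]
  exact besselLambda_le_exp d
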